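/- Let $N\ge 0$ and let $k$ be a non-negative integer with $k>N/2$. Let $m:\mathbb R^N\to\mathbb C$ be a function such that $m\equiv 0$ in a neighborhood of $0$ and $1-m\in H^k(\mathbb R^N)=W^{k,2}(\mathbb R^N)$, i.e. all distributional derivatives of $1-m$ of order at most $k$ are in $L^2(dx)$. Then $m$ agrees Lebesgue-almost everywhere with a (unique) continuous function, which we again denote by $m$, and the functions $$M_\varepsilon(s,t):=m\big((t-s)/\varepsilon\big),\qquad \varepsilon>0,\ s,t\in\mathbb R^N,$$ have the following properties. 1. For every $a>0$, $M_\varepsilon(s,t)\to 1$ as $\varepsilon\to0^+$, uniformly on $\{(s,t)\in\mathbb R^N\times\mathbb R^N: |s-t|>a\}$. 2. Let $\mu,\nu$ be Radon measures on $\mathbb R^N$ and let $K$ be a singular kernel with respect to them, i.e. a complex-valued function $K(s,t)$ on $\mathbb R^N\times\mathbb R^N$ that is measurable for the product measure $d\nu(s)\,d\mu(t)$ and square integrable with respect to it on every compact subset of $\{(s,t): s\neq t\}$. Then for every $\varepsilon>0$ the kernel $K_\varepsilon:=KM_\varepsilon$ is square integrable with respect to $d\nu(s)\,d\mu(t)$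 on every compact subset of $\mathbb R^N\times\mathbb R^N$; consequently $T_\varepsilon f(s):=\int K_\varepsilon(s,t)f(t)\,d\mu(t)$ is well defined for every bounded compactly supported Borel function $f$: the integral converges absolutely for $\nu$-a.e. $s$ and $T_\varepsilon f$ is $\nu$-measurable. 3. Let $1<p<\infty$ and $1/p+1/p'=1$, let $\mu,\nu$ be Radon measures on $\mathbb R^N$ without common atoms, and let $K$ be a singular kernel that is restrictedly bounded in $L^p$, i.e. there is $C<\infty$ such that $$\left|\iint K(s,t)f(t)g(s)\,d\mu(t)\,d\nu(s)\right|\le C\|f\|_{L^p(\mu)}\|g\|_{L^{p'}(\nu)}$$ for all bounded Borel functions $f,g$ with compact supports satisfying $\operatorname{dist}(\operatorname{supp}f,\operatorname{supp}g)>0$. Then the operators $T_\varepsilon$ are bounded from $L^p(\mu)$ to $L^p(\nu)$ uniformly in $\varepsilon$: there is $C'<\infty$ such that for every $\varepsilon>0$ the operator $T_\varepsilon$, initially defined on bounded compactly supported Borel functions, extends to a bounded linear operator $L^p(\mu)\to L^p(\nu)$ of norm at most $C'$. -/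

import Mathlib

open MeasureTheory Set Filter Topology
open scoped ENNReal NNReal SchwartzMap LineDeriv

noncomputable section

/-- The space `ℝ^N` with its Euclidean norm. -/
abbrev RN (N : ℕ) : Type := EuclideanSpace ℝ (Fin N)

/-- The Sobolev space `H^k(ℝ^N) = W^{k,2}(ℝ^N)`: the function `u` is in `L²(dx)`, and every partial
derivative `∂_{i_1} ⋯ ∂_{i_n} u` of order `n ≤ k`, taken in the sense of (tempered) distributions,
is an `L²(dx)` function. -/
def MemHk {N : ℕ} (k : ℕ) (u : RN N → ℂ) : Prop :=
  ∃ hu : MemLp u 2 (volume : Measure (RN N)),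
    ∀ n : ℕ, n ≤ k → ∀ i : Fin n → Fin N,
      ∃ g : Lp ℂ 2 (volume : Measure (RN N)),
        ∂^{fun j => (EuclideanSpace.single (i j) 1 : RN N)}
          ((hu.toLp u : Lp ℂ 2 (volume : Measure (RN N))) : 𝓢'(RN N, ℂ)) = (g : 𝓢'(RN N, ℂ))

/-- `K` is locally `L²(σ)` on the set `U`: it is square integrable on every compact subset. -/
def LocallyL2On {X : Type*} [TopologicalSpace X] [MeasurableSpace X]
    (K : X → ℂ) (σ : Measure X) (U : Set X) : Prop :=
  ∀ Q : Set X, Q ⊆ U → IsCompact Q → MemLp K 2 (σ.restrict Q)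

/-- Singular kernels `K(s, t)`. The first variable `s` is the one integrated against `ν`, the second
variable `t` is the one integrated against `μ`, so that the product measure on pairs `(s, t)` is
`ν.prod μ`. The kernel is measurable (for the completed product measure) and locally `L²` off the
diagonal. -/
def IsSingularKernel {N : ℕ} (μ ν : Measure (RN N)) (K : RN N × RN N → ℂ) : Prop :=
  AEStronglyMeasurable K (ν.prod μ) ∧ LocallyL2On K (ν.prod μ) {z | z.1 ≠ z.2}

/-- Bounded Borel measurable functions with compact support. -/
structure IsTestFun {N : ℕ} (f : RN N → ℂ) : Prop where
  measurable : Measurable f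
  bounded : ∃ B : ℝ, ∀ x, ‖f x‖ ≤ B
  hasCompactSupport : HasCompactSupport f

theorem IsTestFun.memLp {N : ℕ} {f : RN N → ℂ} (hf : IsTestFun f) (p : ℝ≥0∞)
    (μ : Measure (RN N)) [IsLocallyFiniteMeasure μ] : MemLp f p μ := by
  obtain ⟨B, hB⟩ := hf.bounded
  have hK : IsCompact (tsupport f) := hf.hasCompactSupport
  have : IsFiniteMeasure (μ.restrict (tsupport f)) := ⟨by simpa using hK.measure_lt_top⟩
  have h1 : MemLp f p (μ.restrict (tsupport f)) :=
    MemLp.of_bound hf.measurable.aestronglyMeasurable B (Eventually.of_forall hB)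
  have h2 := (memLp_indicator_iff_restrict (isClosed_tsupport f).measurableSet).2 h1
  rwa [Set.indicator_eq_self.2 (subset_tsupport f)] at h2

/-- The kernel `K` is restrictedly bounded in `L^p` with bound `C`, where `q = p'` is the conjugate
exponent: `|∬ K(s, t) f(t) g(s) dμ(t) dν(s)| ≤ C ‖f‖_{L^p(μ)} ‖g‖_{L^q(ν)}` for all bounded `f`, `g`
with compact supports at a positive distance from each other. -/
def RestrictedlyBounded {N : ℕ} (p q : ℝ≥0∞) (μ ν : Measure (RN N)) (K : RN N × RN N → ℂ)
    (C : ℝ≥0) : Prop :=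
  ∀ f g : RN N → ℂ, IsTestFun f → IsTestFun g →
    Metric.AreSeparated (tsupport f) (tsupport g) →
    ‖∫ z, K z * f z.2 * g z.1 ∂(ν.prod μ)‖ₑ ≤ C * eLpNorm f p μ * eLpNorm g q ν

/-- The integral operator `(T f)(s) = ∫ K(s, t) f(t) dμ(t)`. -/
def integralOp {N : ℕ} (μ : Measure (RN N)) (K : RN N × RN N → ℂ) (f : RN N → ℂ) : RN N → ℂ :=
  fun s => ∫ t, K (s, t) * f t ∂μ

/-- The integral operator with kernel `K` is well defined on bounded compactly supported functions:
the integral defining `(T f)(s)` converges absolutely for `ν`-almost all `s`, and `T f` is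
`ν`-measurable. -/
def IntegralOpWellDefined {N : ℕ} (μ ν : Measure (RN N)) (K : RN N × RN N → ℂ) : Prop :=
  ∀ f : RN N → ℂ, IsTestFun f →
    (∀ᵐ s ∂ν, Integrable (fun t => K (s, t) * f t) μ) ∧
      AEStronglyMeasurable (integralOp μ K f) ν

/-- The integral operator with kernel `K`, initially defined on the bounded compactly supported
functions, extends to a bounded operator `L^p(μ) → L^p(ν)` of norm at most `C`. -/
def IntegralOpBounded {N : ℕ} (p : ℝ≥0∞) [Fact (1 ≤ p)] (μ ν : Measure (RN N))
    [IsLocallyFiniteMeasure μ] (K : RN N × RN N → ℂ) (C : ℝ) : Prop :=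
  IntegralOpWellDefined μ ν K ∧
    ∃ S : Lp ℂ p μ →L[ℂ] Lp ℂ p ν, ‖S‖ ≤ C ∧
      ∀ (f : RN N → ℂ) (hf : IsTestFun f),
        (S ((hf.memLp p μ).toLp f) : RN N → ℂ) =ᵐ[ν] integralOp μ K f

/-- The multiplier `M_ε(s, t) = m((t - s) / ε)`. -/
def mollifier {N : ℕ} (m : RN N → ℂ) (ε : ℝ) (z : RN N × RN N) : ℂ :=
  m (ε⁻¹ • (z.2 - z.1))

end

/-! By Sobolev embedding, `1 - m` is almost everywhere the Fourier transform of an integrable `v`,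
because `k > N / 2`. Thus `m' = 1 - 𝓕 v` is continuous, tends to `1` at infinity by
Riemann–Lebesgue, and vanishes near `0`. The decay gives (1). The vanishing keeps `K M_ε` off a
uniform neighborhood of the diagonal, which gives (2).

For (3), `M_ε(s, t)` is `1` minus the integral over `ξ` of `v ξ` times a character of `(t - s) / ε`.
A character of `t - s` is a unimodular function of `t` times one of `s`, so it can be absorbed into
`f` and `g` without changing supports or norms. Hence `K M_ε` is restrictedly bounded with constant
`C (1 + ‖v‖₁)`, whatever `ε` is (`RestrictedlyBounded.mul_mollifier`).

It remains to drop the separation of supports, now for a locally `L²` kernel. Inner regularity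
reaches disjoint supports (`RestrictedlyBounded.of_disjoint`). Next, the space is cut into finitely
many pieces, which are colored at random with two colors: two points of different pieces get the
colors (true, false) with probability `1/4`, so averaging over colorings costs a factor `4`
(`RestrictedlyBounded.setIntegral_ne_le`). Finer partitions exhaust the complement of the diagonal,
which is null in the absence of common atoms. Duality and density then give the operator. -/

/-! ### Sobolev embedding through the Fourier transform -/

open TemperedDistribution FourierTransform in
/-- The Bessel potential of order `2` is `1 - (2π)⁻² Δ`. -/
theorem besselPotential_two_eq_sub_laplacian {N : ℕ} (f : 𝓢'(RN N, ℂ)) :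
    besselPotential (RN N) ℂ 2 f =
      f + (((2 * Real.pi) ^ 2)⁻¹ : ℝ) • (-Laplacian.laplacian f) := by
  have hg : (fun x : RN N => (((1 + ‖x‖ ^ 2) ^ ((2 : ℝ) / 2) : ℝ) : ℂ)) =
      (fun _ => (1 : ℂ)) + fun x => Complex.ofReal (‖x‖ ^ 2) := by
    ext x; simp
  rw [laplacian_eq_fourierMultiplierCLM, besselPotential, hg]
  simp only [fourierMultiplierCLM_apply]
  rw [smulLeftCLM_add (by fun_prop) (by fun_prop)]
  simp only [add_apply, smulLeftCLM_const, one_smul]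
  rw [fourierInv_add, fourierInv_fourier_eq]
  congr 1
  rw [neg_smul, neg_neg, smul_smul, inv_mul_cancel₀ (by positivity), one_smul]

open TemperedDistribution in
/-- If `f` and all its first order partial derivatives are in `H^s`, then `f` is in `H^{s+1}`. -/
theorem memSobolev_add_one_of_lineDeriv {N : ℕ} {s : ℝ} {f : 𝓢'(RN N, ℂ)}
    (hf : MemSobolev s 2 f)
    (hd : ∀ j : Fin N, MemSobolev s 2 (∂_{(EuclideanSpace.single j 1 : RN N)} f)) :
    MemSobolev (s + 1) 2 f := by
  -- The Bessel potential of order `2` lowers the Sobolev order by exactly `2`, so only `f` and `Δ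
  -- f` need to be in `H^{s-1}`; each `∂_j ∂_j f` is there because `∂_j f` is in `H^s`.
  have h1 : s + 1 = 2 + (s - 1) := by ring
  rw [h1, ← memSobolev_besselPotential_iff, besselPotential_two_eq_sub_laplacian]
  refine (hf.mono (by linarith)).add ?_
  have h2 : MemSobolev (s - 1) 2 (-Laplacian.laplacian f) := by
    refine MemSobolev.neg ?_
    rw [laplacian_eq_sum (EuclideanSpace.basisFun (Fin N) ℝ) f]
    refine Finset.sum_induction _ (MemSobolev (s - 1) 2) (fun a b => MemSobolev.add) (by simp) ?_
    intro j _
    simpa using (hd j).lineDerivOp (m := (EuclideanSpace.single j 1 : RN N))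
  have h3 := h2.smul ((((2 * Real.pi) ^ 2)⁻¹ : ℝ) : ℂ)
  have h4 : (((2 * Real.pi) ^ 2)⁻¹ : ℝ) • (-Laplacian.laplacian f) =
      ((((2 * Real.pi) ^ 2)⁻¹ : ℝ) : ℂ) • (-Laplacian.laplacian f) := by
    ext φ
    exact (Complex.coe_smul _ _).symm
  rw [h4]
  exact h3

-- Regularity is traded for derivatives: by induction on `s`, every derivative of order `n ≤ k - s`
-- lies in `H^s`. The case `s = 0` is the hypothesis, and `s = k`, `n = 0` is the claim.
open TemperedDistribution in
theorem MemHk.exists_memSobolev {N k : ℕ} {u : RN N → ℂ} (hu : MemHk k u) :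
    ∃ h : MemLp u 2 (volume : Measure (RN N)),
      MemSobolev (k : ℝ) 2 ((h.toLp u : Lp ℂ 2 (volume : Measure (RN N))) : 𝓢'(RN N, ℂ)) := by
  obtain ⟨h, hd⟩ := hu
  refine ⟨h, ?_⟩
  set f : 𝓢'(RN N, ℂ) := ((h.toLp u : Lp ℂ 2 (volume : Measure (RN N))) : 𝓢'(RN N, ℂ))
  have key : ∀ s n : ℕ, n + s ≤ k → ∀ i : Fin n → Fin N,
      MemSobolev (s : ℝ) 2 (∂^{fun j => (EuclideanSpace.single (i j) 1 : RN N)} f) := by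
    intro s
    induction s with
    | zero =>
      intro n hn i
      simpa [memSobolev_zero_iff] using hd n (by simpa using hn) i
    | succ s ih =>
      intro n hn i
      push_cast
      refine memSobolev_add_one_of_lineDeriv (ih n (by omega) i) fun j => ?_
      have := ih (n + 1) (by omega) (Fin.cons j i)
      rw [LineDeriv.iteratedLineDerivOp_succ_left] at this
      exact this
  simpa using key k 0 (by simp) Fin.elim0

open FourierTransform TemperedDistribution in
/-- If the distributional Fourier transform of an `L²` function `u` is an integrable function `v`,
then `u` is almost everywhere the inverse Fourier integral of `v`. -/
theorem ae_eq_fourierInv_of_fourier_eq {N : ℕ} (u : Lp ℂ 2 (volume : Measure (RN N)))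
    (v : Lp ℂ 1 (volume : Measure (RN N)))
    (h : 𝓕 (u : 𝓢'(RN N, ℂ)) = (v : 𝓢'(RN N, ℂ))) :
    (u : RN N → ℂ) =ᵐ[volume] 𝓕⁻ (v : RN N → ℂ) := by
  have hv : Integrable (v : RN N → ℂ) := L1.integrable_coeFn v
  have hcont : Continuous (𝓕⁻ (v : RN N → ℂ)) := by
    rw [Real.fourierInv_eq_fourier_comp_neg]
    exact VectorFourier.fourierIntegral_continuous Real.continuous_fourierChar
      (innerSL ℝ).continuous₂ hv.comp_neg
  refine ae_eq_of_integral_contDiff_smul_eq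
    ((Lp.memLp u).locallyIntegrable (by norm_num)) hcont.locallyIntegrable ?_
  intro g hg hgs
  have hgs' : HasCompactSupport (fun x => (g x : ℂ)) :=
    hgs.comp_left (g := fun r : ℝ => (r : ℂ)) (by simp)
  have hg' : ContDiff ℝ (⊤ : ℕ∞) (fun x => (g x : ℂ)) := Complex.ofRealCLM.contDiff.comp hg
  let φ : 𝓢(RN N, ℂ) := hgs'.toSchwartzMap hg'
  have hφ : ∀ x, φ x = (g x : ℂ) := fun x => rfl
  have h1 : (u : 𝓢'(RN N, ℂ)) φ = (v : 𝓢'(RN N, ℂ)) (𝓕⁻ φ) := by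
    rw [← h, TemperedDistribution.fourier_apply, fourier_fourierInv_eq]
  rw [Lp.toTemperedDistribution_apply, Lp.toTemperedDistribution_apply] at h1
  have h2 : ∫ x, g x • (u : RN N → ℂ) x = ∫ x, φ x • (u : RN N → ℂ) x := by
    simp [hφ]
  have h3 : ∫ x, g x • 𝓕⁻ (v : RN N → ℂ) x = ∫ x, φ x • 𝓕⁻ (v : RN N → ℂ) x := by
    simp [hφ]
  rw [h2, h3, h1, SchwartzMap.fourierInv_coe]
  -- The inverse transform is the Fourier integral for the pairing `-⟨x, y⟩`. That pairing is
  -- symmetric, so the transform can be moved from `φ` to `v`.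
  have h4 := VectorFourier.integral_fourierIntegral_smul_eq_flip (L := -innerₗ (RN N))
    (μ := volume) (ν := volume) (f := (φ : RN N → ℂ)) (g := (v : RN N → ℂ))
    Real.continuous_fourierChar continuous_inner.neg φ.integrable hv
  have hflip : (-innerₗ (RN N)).flip = -innerₗ (RN N) := by
    ext x y
    simp [real_inner_comm]
  rw [hflip] at h4
  exact h4

open FourierTransform in
/-- The Sobolev embedding theorem, in the form: a function in `H^k`, `k > N / 2`, is the Fourier
transform of an integrable function. -/
theorem MemHk.exists_ae_eq_fourier {N k : ℕ} (hk : (N : ℝ) / 2 < k) {u : RN N → ℂ}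
    (hu : MemHk k u) : ∃ v : RN N → ℂ, Integrable v ∧ u =ᵐ[volume] 𝓕 v := by
  obtain ⟨h, hs⟩ := hu.exists_memSobolev
  -- Cauchy–Schwarz: the transform is an `L²` function times `(1 + |ξ|²)^{-k/2}`, which is in `L²`
  -- since `2k > N`.
  obtain ⟨v, hv⟩ := hs.fourier_memL1 (by rw [finrank_euclideanSpace_fin]; linarith)
  refine ⟨fun x => v (-x), (L1.integrable_coeFn v).comp_neg, ?_⟩
  have h1 := ae_eq_fourierInv_of_fourier_eq _ v hv
  rw [Real.fourierInv_eq_fourier_comp_neg] at h1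
  exact h.coeFn_toLp.symm.trans h1

open FourierTransform in
theorem continuous_fourier_of_integrable {N : ℕ} {v : RN N → ℂ} (hv : Integrable v) :
    Continuous (𝓕 v) :=
  VectorFourier.fourierIntegral_continuous Real.continuous_fourierChar
    (innerSL ℝ).continuous₂ hv

/-! ### The multipliers away from and near the diagonal -/

/-- If `m x → 1` at infinity, then the multipliers `M_ε` tend to `1` uniformly away from the
diagonal. -/
theorem tendstoUniformlyOn_mollifier {N : ℕ} {m : RN N → ℂ}
    (hm : Tendsto m (cocompact (RN N)) (𝓝 1)) {a : ℝ} (ha : 0 < a) :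
    TendstoUniformlyOn (mollifier m) (fun _ => (1 : ℂ)) (𝓝[>] (0 : ℝ)) {z | a < dist z.1 z.2} := by
  rw [Metric.tendstoUniformlyOn_iff]
  intro η hη
  obtain ⟨R, -, hR⟩ := (Metric.hasBasis_cobounded_compl_closedBall (0 : RN N)).mem_iff.1
    (Metric.cobounded_eq_cocompact (α := RN N) ▸ hm (Metric.ball_mem_nhds 1 hη))
  have h1 : Tendsto (fun ε : ℝ => ε⁻¹ * a) (𝓝[>] 0) atTop :=
    tendsto_inv_nhdsGT_zero.atTop_mul_const ha
  filter_upwards [h1.eventually_ge_atTop R, self_mem_nhdsWithin] with ε hε hε0 z hz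
  have hε0 : 0 < ε := hε0
  have hz : a < dist z.1 z.2 := hz
  rw [dist_comm]
  refine hR ?_
  simp only [mem_compl_iff, Metric.mem_closedBall, dist_zero_right, not_le, norm_smul, norm_inv,
    Real.norm_eq_abs, abs_of_pos hε0]
  rw [← dist_eq_norm, dist_comm]
  exact hε.trans_lt (mul_lt_mul_of_pos_left hz (inv_pos.2 hε0))

/-- The product of a singular kernel and a continuous function vanishing in a uniform neighborhood
of the diagonal is locally square integrable everywhere. -/
theorem IsSingularKernel.locallyL2On_mul {N : ℕ} {μ ν : Measure (RN N)} {K : RN N × RN N → ℂ}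
    (hK : IsSingularKernel μ ν K) {M : RN N × RN N → ℂ} (hM : Continuous M) {δ : ℝ} (hδ : 0 < δ)
    (h0 : ∀ z : RN N × RN N, dist z.1 z.2 < δ → M z = 0) :
    LocallyL2On (fun z => K z * M z) (ν.prod μ) univ := by
  intro Q _ hQ
  have hcl : IsClosed {z : RN N × RN N | δ ≤ dist z.1 z.2} :=
    isClosed_le continuous_const (continuous_fst.dist continuous_snd)
  have hind : (fun z => K z * M z) =
      {z : RN N × RN N | δ ≤ dist z.1 z.2}.indicator (fun z => K z * M z) := by
    symm
    rw [Set.indicator_eq_self]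
    intro z hz
    by_contra hlt
    exact hz (by simp [h0 z (not_le.1 hlt)])
  rw [hind, memLp_indicator_iff_restrict hcl.measurableSet,
    Measure.restrict_restrict hcl.measurableSet]
  have hQ' := hQ.inter_left hcl
  obtain ⟨B, hB⟩ := hQ'.exists_bound_of_continuousOn hM.continuousOn
  have hKQ := hK.2 _ (fun z hz => dist_pos.1 (hδ.trans_le hz.1)) hQ'
  refine MemLp.of_le_mul (c := B) hKQ
    (hKQ.1.mul hM.aestronglyMeasurable) ?_
  refine (ae_restrict_iff' hQ'.measurableSet).2 (Eventually.of_forall fun z hz => ?_)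
  rw [norm_mul, mul_comm]
  exact mul_le_mul_of_nonneg_right (hB z hz) (norm_nonneg _)

/-! ### Test functions and absolute convergence -/

/-- `K(s, t) f(t) g(s)` is integrable as soon as `K` is square integrable on the product of the
supports of the test functions `g` and `f`. -/
theorem IsTestFun.integrable_kernel_mul {N : ℕ} {μ ν : Measure (RN N)} [IsLocallyFiniteMeasure μ]
    [IsLocallyFiniteMeasure ν] {K : RN N × RN N → ℂ} {f g : RN N → ℂ} (hf : IsTestFun f)
    (hg : IsTestFun g) (hK : MemLp K 2 ((ν.prod μ).restrict (tsupport g ×ˢ tsupport f))) :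
    Integrable (fun z => K z * f z.2 * g z.1) (ν.prod μ) := by
  have hc : IsCompact (tsupport g ×ˢ tsupport f) := hg.hasCompactSupport.prod hf.hasCompactSupport
  have : IsFiniteMeasure ((ν.prod μ).restrict (tsupport g ×ˢ tsupport f)) :=
    ⟨by simpa using hc.measure_lt_top (μ := ν.prod μ)⟩
  obtain ⟨A, hA⟩ := hf.bounded
  obtain ⟨B, hB⟩ := hg.bounded
  rw [← integrableOn_iff_integrable_of_support_subset (s := tsupport g ×ˢ tsupport f)]
  · exact ((hK.integrable one_le_two).mul_bdd
      (hf.measurable.comp measurable_snd).aestronglyMeasurable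
      (Eventually.of_forall fun z => hA z.2)).mul_bdd
      (hg.measurable.comp measurable_fst).aestronglyMeasurable
      (Eventually.of_forall fun z => hB z.1)
  · intro z hz
    simp only [Function.mem_support, ne_eq, mul_eq_zero, not_or] at hz
    exact ⟨subset_tsupport g hz.2, subset_tsupport f hz.1.2⟩

theorem IsTestFun.of_subset {N : ℕ} {f g : RN N → ℂ} (hf : IsTestFun f) (hg : Measurable g)
    (h : ∀ x, ‖g x‖ ≤ ‖f x‖) : IsTestFun g := by
  refine ⟨hg, ?_, hf.hasCompactSupport.mono fun x hx => ?_⟩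
  · obtain ⟨B, hB⟩ := hf.bounded
    exact ⟨B, fun x => (h x).trans (hB x)⟩
  · rw [Function.mem_support] at hx ⊢
    rw [← norm_pos_iff] at hx ⊢
    exact hx.trans_le (h x)

theorem IsTestFun.indicator {N : ℕ} {f : RN N → ℂ} (hf : IsTestFun f) {s : Set (RN N)}
    (hs : MeasurableSet s) : IsTestFun (s.indicator f) :=
  hf.of_subset (hf.measurable.indicator hs) fun x => norm_indicator_le_norm_self f x

theorem isTestFun_indicator_closedBall {N : ℕ} (R : ℝ) :
    IsTestFun ((Metric.closedBall (0 : RN N) R).indicator fun _ => (1 : ℂ)) := by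
  refine ⟨measurable_const.indicator Metric.isClosed_closedBall.measurableSet, ⟨1, fun x => ?_⟩, ?_⟩
  · simpa using norm_indicator_le_norm_self (fun _ : RN N => (1 : ℂ)) x
  · exact HasCompactSupport.intro (isCompact_closedBall (0 : RN N) R) fun x hx => by
      simp [Set.indicator_of_notMem hx]

/-- Fubini, applied with `g` the indicator of a ball, gives absolute convergence for almost every
`s` in that ball; countably many balls cover the space. -/
theorem integralOpWellDefined_of_locallyL2On {N : ℕ} {μ ν : Measure (RN N)}
    [IsLocallyFiniteMeasure μ] [IsLocallyFiniteMeasure ν] {K : RN N × RN N → ℂ}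
    (hm : AEStronglyMeasurable K (ν.prod μ)) (hK : LocallyL2On K (ν.prod μ) univ) :
    IntegralOpWellDefined μ ν K := by
  intro f hf
  constructor
  · have h : ∀ n : ℕ, ∀ᵐ s ∂ν, s ∈ Metric.closedBall (0 : RN N) n →
        Integrable (fun t => K (s, t) * f t) μ := by
      intro n
      have hg := isTestFun_indicator_closedBall (N := N) n
      have := (hf.integrable_kernel_mul hg (hK _ (subset_univ _)
        (hg.hasCompactSupport.prod hf.hasCompactSupport))).prod_right_ae
      filter_upwards [this] with s hs hsn
      simpa [Set.indicator_of_mem hsn] using hs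
    filter_upwards [ae_all_iff.2 h] with s hs
    obtain ⟨n, hn⟩ := exists_nat_ge ‖s‖
    exact hs n (by simpa using hn)
  · exact (hm.mul (hf.measurable.comp measurable_snd).aestronglyMeasurable).integral_prod_right'

theorem Metric.AreSeparated.prod_subset_offDiag {X : Type*} [PseudoEMetricSpace X] {s t : Set X}
    (h : Metric.AreSeparated s t) : t ×ˢ s ⊆ {z : X × X | z.1 ≠ z.2} := by
  rintro ⟨x, y⟩ ⟨hx, hy⟩ hxy
  obtain ⟨r, hr, hst⟩ := h
  have hxy : x = y := hxy
  subst hxy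
  exact hr (by simpa using hst x hy x hx)

/-! ### Averaging over characters -/

theorem continuous_circle_coe : Continuous (fun z : Circle => (z : ℂ)) := by fun_prop

/-- Multiplication by a unimodular function does not change the support, the bounds and the norms
of a test function. -/
theorem IsTestFun.circle_smul {N : ℕ} {f : RN N → ℂ} (hf : IsTestFun f) {a : RN N → Circle}
    (ha : Continuous a) : IsTestFun (fun x => a x • f x) := by
  refine hf.of_subset ?_ fun x => by simp
  simp only [Circle.smul_def, smul_eq_mul]
  exact (continuous_circle_coe.comp ha).measurable.mul hf.measurable

theorem tsupport_circle_smul {X : Type*} [TopologicalSpace X] (a : X → Circle) (f : X → ℂ) :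
    tsupport (fun x => a x • f x) = tsupport f := by
  have : Function.support (fun x => a x • f x) = Function.support f := by
    ext x
    simp [Circle.smul_def]
  rw [tsupport, this, tsupport]

theorem eLpNorm_circle_smul {X : Type*} [MeasurableSpace X] (a : X → Circle) (f : X → ℂ)
    (p : ℝ≥0∞) (μ : Measure X) : eLpNorm (fun x => a x • f x) p μ = eLpNorm f p μ :=
  eLpNorm_congr_norm_ae (Eventually.of_forall fun x => by simp)

open FourierTransform in
/-- The multiplier built from the Fourier transform of an integrable function is a Schur multiplier
of restrictedly bounded kernels: it is an average of unimodular functions `a(t) b(s)`. -/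
theorem RestrictedlyBounded.mul_mollifier {N : ℕ} {p q : ℝ≥0∞} {μ ν : Measure (RN N)}
    [IsLocallyFiniteMeasure μ] [IsLocallyFiniteMeasure ν] {K : RN N × RN N → ℂ} {C : ℝ≥0}
    (hK : IsSingularKernel μ ν K) (hC : RestrictedlyBounded p q μ ν K C) {v : RN N → ℂ}
    (hv : Integrable v) (ε : ℝ) :
    RestrictedlyBounded p q μ ν (fun z => K z * mollifier (fun x => 1 - 𝓕 v x) ε z)
      (C * (1 + (∫⁻ ξ, ‖v ξ‖ₑ).toNNReal)) := by
  intro f g hf hg hfg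
  have hint : Integrable (fun z => K z * f z.2 * g z.1) (ν.prod μ) :=
    hf.integrable_kernel_mul hg (hK.2 _ hfg.prod_subset_offDiag
      (hg.hasCompactSupport.prod hf.hasCompactSupport))
  set h : RN N × RN N → ℂ := fun z => K z * f z.2 * g z.1 with hh
  set B : ℝ≥0∞ := C * eLpNorm f p μ * eLpNorm g q ν with hB
  let e : RN N → RN N × RN N → Circle := fun ξ z =>
    Real.fourierChar (-inner ℝ ξ (ε⁻¹ • (z.2 - z.1)))
  have he : Continuous (Function.uncurry e) := by
    refine Real.continuous_fourierChar.comp (Continuous.neg (Continuous.inner ?_ ?_)) <;> fun_prop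
  -- the bound for each character
  have hchar : ∀ ξ, ‖∫ z, e ξ z • h z ∂(ν.prod μ)‖ₑ ≤ B := by
    intro ξ
    -- The character of `t - s` factors as `a t * b s`, so the hypothesis applies to `a • f` and `b
    -- • g`.
    let a : RN N → Circle := fun t => Real.fourierChar (-inner ℝ ξ (ε⁻¹ • t))
    let b : RN N → Circle := fun s => Real.fourierChar (inner ℝ ξ (ε⁻¹ • s))
    have ha : Continuous a := by
      refine Real.continuous_fourierChar.comp (Continuous.neg (Continuous.inner ?_ ?_)) <;> fun_prop
    have hb : Continuous b := by
      refine Real.continuous_fourierChar.comp (Continuous.inner ?_ ?_) <;> fun_prop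
    have hab := hC (fun t => a t • f t) (fun s => b s • g s) (hf.circle_smul ha)
      (hg.circle_smul hb) (by simpa only [tsupport_circle_smul] using hfg)
    rw [eLpNorm_circle_smul, eLpNorm_circle_smul] at hab
    convert hab using 3
    ext z
    have : e ξ z = a z.2 * b z.1 := by
      simp only [e, a, b]
      rw [← AddChar.map_add_eq_mul, smul_sub, inner_sub_right]
      congr 1
      ring
    rw [this, hh]
    simp only [Circle.smul_def, smul_eq_mul, Circle.coe_mul]
    ring
  have hprod : Integrable (Function.uncurry fun z ξ => h z * (e ξ z • v ξ))
      ((ν.prod μ).prod volume) := by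
    -- The character has modulus one, so Fubini only needs the tensor product of `h` and `v` to be
    -- integrable.
    have h1 : Integrable (fun w : (RN N × RN N) × RN N => h w.1 * v w.2)
        ((ν.prod μ).prod volume) := hint.mul_prod hv
    refine h1.congr' ?_ (Eventually.of_forall fun w => ?_)
    · have h2 : AEStronglyMeasurable (fun w : (RN N × RN N) × RN N => (e w.2 w.1 : ℂ))
          ((ν.prod μ).prod volume) :=
        (continuous_circle_coe.comp (he.comp continuous_swap)).aestronglyMeasurable
      refine (h2.mul h1.1).congr (Eventually.of_forall fun w => ?_)
      simp only [Pi.mul_apply, Function.uncurry, Circle.smul_def, smul_eq_mul]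
      ring
    · simp [Function.uncurry]
  have hfour : ∀ z, h z * 𝓕 v (ε⁻¹ • (z.2 - z.1)) = ∫ ξ, h z * (e ξ z • v ξ) := by
    intro z
    rw [Real.fourier_eq, ← integral_const_mul]
  have hint2 : Integrable (fun z => h z * 𝓕 v (ε⁻¹ • (z.2 - z.1))) (ν.prod μ) := by
    simp_rw [hfour]
    exact hprod.integral_prod_left
  have hsplit : ∫ z, K z * mollifier (fun x => 1 - 𝓕 v x) ε z * f z.2 * g z.1 ∂(ν.prod μ) =
      ∫ z, h z ∂(ν.prod μ) - ∫ ξ, v ξ * ∫ z, e ξ z • h z ∂(ν.prod μ) := by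
    have h3 : ∫ z, h z * 𝓕 v (ε⁻¹ • (z.2 - z.1)) ∂(ν.prod μ) =
        ∫ ξ, v ξ * ∫ z, e ξ z • h z ∂(ν.prod μ) := by
      simp_rw [hfour]
      rw [integral_integral_swap hprod]
      refine integral_congr_ae (Eventually.of_forall fun ξ => ?_)
      simp only
      rw [← integral_const_mul]
      refine integral_congr_ae (Eventually.of_forall fun z => ?_)
      simp only [Circle.smul_def, smul_eq_mul]
      ring
    rw [← h3, ← integral_sub hint hint2]
    refine integral_congr_ae (Eventually.of_forall fun z => ?_)
    simp only [mollifier, hh]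
    ring
  have hvfin : ∫⁻ ξ, ‖v ξ‖ₑ ≠ ∞ := hv.2.ne
  rw [hsplit]
  calc ‖∫ z, h z ∂(ν.prod μ) - ∫ ξ, v ξ * ∫ z, e ξ z • h z ∂(ν.prod μ)‖ₑ
      ≤ ‖∫ z, h z ∂(ν.prod μ)‖ₑ + ‖∫ ξ, v ξ * ∫ z, e ξ z • h z ∂(ν.prod μ)‖ₑ := enorm_sub_le
    _ ≤ B + ∫⁻ ξ, ‖v ξ‖ₑ * B := by
        refine add_le_add (hC f g hf hg hfg) ((enorm_integral_le_lintegral_enorm _).trans ?_)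
        refine lintegral_mono fun ξ => ?_
        rw [enorm_mul]
        exact mul_le_mul_right (hchar ξ) _
    _ = B + (∫⁻ ξ, ‖v ξ‖ₑ) * B := by rw [lintegral_mul_const'' _ hv.1.enorm]
    _ = _ := by
        rw [ENNReal.coe_mul, ENNReal.coe_add, ENNReal.coe_toNNReal hvfin, hB, ENNReal.coe_one]
        ring

/-! ### From separated to disjoint supports -/

theorem IsCompact.areSeparated_of_disjoint {X : Type*} [EMetricSpace X] {s t : Set X}
    (hs : IsCompact s) (ht : IsClosed t) (hst : Disjoint s t) : Metric.AreSeparated s t := by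
  obtain ⟨r, hr, h⟩ := Metric.exists_pos_forall_lt_edist hs ht hst
  exact ⟨r, by simpa using hr.ne', fun x hx y hy => (h x hx y hy).le⟩

theorem tsupport_indicator_subset {X : Type*} [TopologicalSpace X] {s : Set X} (hs : IsClosed s)
    (f : X → ℂ) : tsupport (s.indicator f) ⊆ s :=
  closure_minimal (support_indicator_subset) hs

/-- A finite measure set is exhausted in measure by a sequence of compact subsets. -/
theorem exists_seq_isCompact_tendsto_measure_diff {X : Type*} [TopologicalSpace X] [T2Space X]
    [MeasurableSpace X] [OpensMeasurableSpace X] {μ : Measure X} [μ.InnerRegularCompactLTTop]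
    {E : Set X} (hE : MeasurableSet E) (hμ : μ E ≠ ∞) :
    ∃ A : ℕ → Set X, (∀ n, A n ⊆ E) ∧ (∀ n, IsCompact (A n)) ∧
      Tendsto (fun n => μ (E \ A n)) atTop (𝓝 0) := by
  -- No shift to `n + 1` is needed: in `ℝ≥0∞` the inverse of `0` is `∞`.
  have h : ∀ n : ℕ, ∃ A ⊆ E, IsCompact A ∧ μ (E \ A) < ((n : ℝ≥0∞))⁻¹ := fun n =>
    hE.exists_isCompact_sdiff_lt hμ (by simp)
  choose A hA hc hlt using h
  exact ⟨A, hA, hc, tendsto_of_tendsto_of_tendsto_of_le_of_le tendsto_const_nhds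
    ENNReal.tendsto_inv_nat_nhds_zero (fun _ => zero_le) fun n => (hlt n).le⟩

/-- For a kernel that is locally square integrable everywhere, a restricted bound extends from
test functions with separated supports to test functions with disjoint supports. -/
theorem RestrictedlyBounded.of_disjoint {N : ℕ} {p q : ℝ≥0∞} {μ ν : Measure (RN N)}
    [IsLocallyFiniteMeasure μ] [IsLocallyFiniteMeasure ν] {K : RN N × RN N → ℂ} {C : ℝ≥0}
    (hK : LocallyL2On K (ν.prod μ) univ) (hC : RestrictedlyBounded p q μ ν K C)
    {f g : RN N → ℂ} (hf : IsTestFun f) (hg : IsTestFun g) (hfg : ∀ x, f x = 0 ∨ g x = 0) :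
    ‖∫ z, K z * f z.2 * g z.1 ∂(ν.prod μ)‖ₑ ≤ C * eLpNorm f p μ * eLpNorm g q ν := by
  have hint : Integrable (fun z => K z * f z.2 * g z.1) (ν.prod μ) :=
    hf.integrable_kernel_mul hg (hK _ (subset_univ _)
      (hg.hasCompactSupport.prod hf.hasCompactSupport))
  set h : RN N × RN N → ℂ := fun z => K z * f z.2 * g z.1 with hh
  set E : Set (RN N) := Function.support f
  set F : Set (RN N) := Function.support g
  have hE : MeasurableSet E := measurableSet_support hf.measurable
  have hF : MeasurableSet F := measurableSet_support hg.measurable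
  have hμE : μ E ≠ ∞ :=
    ((measure_mono (subset_tsupport f)).trans_lt hf.hasCompactSupport.isCompact.measure_lt_top).ne
  have hνF : ν F ≠ ∞ :=
    ((measure_mono (subset_tsupport g)).trans_lt hg.hasCompactSupport.isCompact.measure_lt_top).ne
  have hEF : Disjoint E F := by
    rw [Set.disjoint_left]
    intro x hx hx'
    exact (hfg x).elim hx hx'
  obtain ⟨A, hAE, hA, hAt⟩ := exists_seq_isCompact_tendsto_measure_diff hE hμE
  obtain ⟨B, hBF, hB, hBt⟩ := exists_seq_isCompact_tendsto_measure_diff hF hνF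
  let S : ℕ → Set (RN N × RN N) := fun n => (F ×ˢ E) \ (B n ×ˢ A n)
  have hS : Tendsto ((ν.prod μ) ∘ S) atTop (𝓝 0) := by
    have hle : ∀ n, ((ν.prod μ) ∘ S) n ≤ ν (F \ B n) * μ E + ν F * μ (E \ A n) := by
      intro n
      rw [← Measure.prod_prod, ← Measure.prod_prod]
      -- A point of `F × E` outside `B n × A n` misses `B n` in the first coordinate or `A n` in the
      -- second.
      refine (measure_mono ?_).trans (measure_union_le _ _)
      rintro ⟨s, t⟩ ⟨⟨hs, ht⟩, hst⟩
      by_cases hsB : s ∈ B n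
      · exact Or.inr ⟨hs, ht, fun htA => hst ⟨hsB, htA⟩⟩
      · exact Or.inl ⟨⟨hs, hsB⟩, ht⟩
    refine tendsto_of_tendsto_of_tendsto_of_le_of_le tendsto_const_nhds ?_ (fun _ => zero_le) hle
    simpa using (ENNReal.Tendsto.mul_const hBt (Or.inr hμE)).add
      (ENNReal.Tendsto.const_mul hAt (Or.inr hνF))
  have hS' : Tendsto (fun n => ∫⁻ z in S n, ‖h z‖ₑ ∂(ν.prod μ)) atTop (𝓝 0) :=
    tendsto_setLIntegral_zero hint.2.ne hS
  have hbound : ∀ n, ‖∫ z, h z ∂(ν.prod μ)‖ₑ ≤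
      C * eLpNorm f p μ * eLpNorm g q ν + ∫⁻ z in S n, ‖h z‖ₑ ∂(ν.prod μ) := by
    intro n
    have hAm := (hA n).measurableSet
    have hBm := (hB n).measurableSet
    have hm : MeasurableSet (B n ×ˢ A n) := hBm.prod hAm
    rw [← integral_add_compl hm hint]
    refine (enorm_add_le _ _).trans (add_le_add ?_ ?_)
    · rw [← integral_indicator hm]
      have hsep : Metric.AreSeparated (tsupport ((A n).indicator f))
          (tsupport ((B n).indicator g)) :=
        (((hA n).areSeparated_of_disjoint (hB n).isClosed
          (hEF.mono (hAE n) (hBF n))).mono_left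
            (tsupport_indicator_subset (hA n).isClosed f)).mono_right
            (tsupport_indicator_subset (hB n).isClosed g)
      have := hC _ _ (hf.indicator hAm) (hg.indicator hBm) hsep
      refine (le_of_eq ?_).trans (this.trans ?_)
      · congr 2
        ext ⟨s, t⟩
        by_cases hs : s ∈ B n <;> by_cases ht : t ∈ A n <;> simp [hh, hs, ht]
      · exact mul_le_mul' (mul_le_mul' le_rfl (eLpNorm_indicator_le f)) (eLpNorm_indicator_le g)
    · refine (enorm_integral_le_lintegral_enorm _).trans (le_of_eq ?_)
      rw [← lintegral_indicator hm.compl, ← lintegral_indicator ((hF.prod hE).diff hm)]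
      refine lintegral_congr fun z => ?_
      by_cases hz : z ∈ F ×ˢ E
      · by_cases hz' : z ∈ B n ×ˢ A n
        · rw [Set.indicator_of_notMem (by simpa using hz'),
            Set.indicator_of_notMem fun H => H.2 hz']
        · rw [Set.indicator_of_mem (by simpa using hz'),
            Set.indicator_of_mem (show z ∈ S n from ⟨hz, hz'⟩)]
      · have h0 : h z = 0 := by
          by_contra hne
          simp only [hh, mul_eq_zero, not_or] at hne
          exact hz ⟨hne.2, hne.1.2⟩
        simp [Set.indicator, h0]
  simpa using ge_of_tendsto' (hS'.const_add (C * eLpNorm f p μ * eLpNorm g q ν)) hbound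

/-! ### From disjoint supports to all test functions by random colorings -/

/-- Among all two-colorings of a finite set, exactly one quarter gives the colors `true` and
`false`, in this order, to two given different points. -/
theorem four_mul_card_coloring {ι : Type*} [Fintype ι] [DecidableEq ι] {a b : ι} (hab : a ≠ b) :
    4 * (Finset.univ.filter fun χ : ι → Bool => χ a = true ∧ χ b = false).card =
      Fintype.card (ι → Bool) := by
  have h : (Finset.univ.filter fun χ : ι → Bool => χ a = true ∧ χ b = false) =
      Fintype.piFinset fun i => if i = a then {true} else if i = b then {false} else Finset.univ := by
    ext χ
    simp only [Finset.mem_filter, Finset.mem_univ, true_and, Fintype.mem_piFinset]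
    constructor
    · rintro ⟨h1, h2⟩ i
      split_ifs with hi hi' <;> simp_all
    · intro h
      refine ⟨by simpa using h a, by simpa [hab.symm] using h b⟩
  rw [h, Fintype.card_piFinset, Fintype.card_pi, ← Finset.mul_prod_erase _ _ (Finset.mem_univ a),
    ← Finset.mul_prod_erase _ _ (Finset.mem_erase.2 ⟨hab.symm, Finset.mem_univ b⟩),
    ← Finset.mul_prod_erase Finset.univ _ (Finset.mem_univ a),
    ← Finset.mul_prod_erase (Finset.univ.erase a) (fun _ => Fintype.card Bool)
      (Finset.mem_erase.2 ⟨hab.symm, Finset.mem_univ b⟩)]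
  simp only [if_true, hab.symm, if_false, Finset.card_singleton, one_mul, Fintype.card_bool]
  rw [← mul_assoc]
  congr 1
  refine Finset.prod_congr rfl fun i hi => ?_
  simp only [Finset.mem_erase, Finset.mem_univ, and_true] at hi
  simp [hi.1, hi.2]

/-- The diagonal is a null set for the product of two measures without common atoms. -/
theorem prod_diagonal_eq_zero {N : ℕ} {μ ν : Measure (RN N)} [SFinite μ] [SFinite ν]
    (hat : ∀ x : RN N, μ {x} = 0 ∨ ν {x} = 0) : (ν.prod μ) {z | z.1 = z.2} = 0 := by
  rw [Measure.measure_prod_null (isClosed_eq continuous_fst continuous_snd).measurableSet]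
  -- There are countably many atoms of `μ`, each `ν`-null; for any other `s` the slice `{s}` of the
  -- diagonal is `μ`-null.
  have hc : {x : RN N | 0 < μ {x}}.Countable :=
    Measure.countable_meas_pos_of_disjoint_iUnion (fun x => measurableSet_singleton x)
      fun x y hxy => by simpa using hxy
  have h0 : ν {x : RN N | 0 < μ {x}} = 0 := by
    rw [← biUnion_of_singleton {x : RN N | 0 < μ {x}}, measure_biUnion_null_iff hc]
    intro x hx
    exact (hat x).resolve_left hx.ne'
  filter_upwards [measure_eq_zero_iff_ae_notMem.1 h0] with s hs
  have : Prod.mk s ⁻¹' {z : RN N × RN N | z.1 = z.2} = {s} := by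
    ext t; simp [eq_comm]
  rw [this]
  simpa using hs

/-- For a kernel that is locally square integrable everywhere and for a measurable map `c` into a
finite set, a restricted bound controls the part of the bilinear form where `c s ≠ c t`. -/
theorem RestrictedlyBounded.setIntegral_ne_le {N : ℕ} {p q : ℝ≥0∞} {μ ν : Measure (RN N)}
    [IsLocallyFiniteMeasure μ] [IsLocallyFiniteMeasure ν] {K : RN N × RN N → ℂ} {C : ℝ≥0}
    (hK : LocallyL2On K (ν.prod μ) univ) (hC : RestrictedlyBounded p q μ ν K C)
    {f g : RN N → ℂ} (hf : IsTestFun f) (hg : IsTestFun g)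
    {ι : Type*} [Fintype ι] [MeasurableSpace ι] [DiscreteMeasurableSpace ι] {c : RN N → ι}
    (hc : Measurable c) :
    ‖∫ z in {z | c z.1 ≠ c z.2}, K z * f z.2 * g z.1 ∂(ν.prod μ)‖ₑ ≤
      4 * C * eLpNorm f p μ * eLpNorm g q ν := by
  classical
  have hint : Integrable (fun z => K z * f z.2 * g z.1) (ν.prod μ) :=
    hf.integrable_kernel_mul hg (hK _ (subset_univ _)
      (hg.hasCompactSupport.prod hf.hasCompactSupport))
  set h : RN N × RN N → ℂ := fun z => K z * f z.2 * g z.1 with hh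
  let D : Set (RN N × RN N) := {z | c z.1 ≠ c z.2}
  have hD : MeasurableSet D :=
    (measurableSet_eq_fun (hc.comp measurable_fst) (hc.comp measurable_snd)).compl
  let A : (ι → Bool) → Set (RN N) := fun χ => c ⁻¹' {i | χ i = true}
  let B : (ι → Bool) → Set (RN N) := fun χ => c ⁻¹' {i | χ i = false}
  have hA : ∀ χ, MeasurableSet (A χ) := fun χ => hc (MeasurableSet.of_discrete)
  have hB : ∀ χ, MeasurableSet (B χ) := fun χ => hc (MeasurableSet.of_discrete)
  set n : ℕ := Fintype.card (ι → Bool) with hn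
  have hn0 : n ≠ 0 := Fintype.card_ne_zero
  -- A coloring `χ` counts at `(s, t)` when `c t` is colored true and `c s` false: never if `c s = c
  -- t`, and for a quarter of the `n` colorings otherwise.
  have hsum : ∀ z, 4 * ∑ χ : ι → Bool, (B χ ×ˢ A χ).indicator h z = n * D.indicator h z := by
    intro z
    have h1 : ∑ χ : ι → Bool, (B χ ×ˢ A χ).indicator h z =
        ((Finset.univ.filter fun χ : ι → Bool => χ (c z.2) = true ∧ χ (c z.1) = false).card : ℂ)
          * h z := by
      rw [Finset.card_filter, Nat.cast_sum, Finset.sum_mul]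
      refine Finset.sum_congr rfl fun χ _ => ?_
      simp only [Set.indicator, mem_prod, A, B, mem_preimage, mem_ofPred_eq]
      cases χ (c z.1) <;> cases χ (c z.2) <;> simp
    rw [h1, ← mul_assoc]
    by_cases hz : c z.1 = c z.2
    · have h2 : z ∉ D := fun H => H hz
      have h3 : (Finset.univ.filter
          fun χ : ι → Bool => χ (c z.2) = true ∧ χ (c z.1) = false) = ∅ := by
        refine Finset.filter_eq_empty_iff.2 fun χ _ => ?_
        rw [hz]; simp
      rw [h3, Set.indicator_of_notMem h2]
      simp
    · rw [Set.indicator_of_mem (show z ∈ D from hz), hn,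
        ← four_mul_card_coloring (fun H => hz H.symm : c z.2 ≠ c z.1)]
      push_cast
      ring
  have hint' : ∀ χ : ι → Bool, Integrable ((B χ ×ˢ A χ).indicator h) (ν.prod μ) := fun χ =>
    hint.indicator ((hB χ).prod (hA χ))
  have hchi : ∀ χ : ι → Bool, ‖∫ z, (B χ ×ˢ A χ).indicator h z ∂(ν.prod μ)‖ₑ ≤
      C * eLpNorm f p μ * eLpNorm g q ν := by
    intro χ
    have hdisj : ∀ x, (A χ).indicator f x = 0 ∨ (B χ).indicator g x = 0 := by
      intro x
      cases hx : χ (c x)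
      · left; exact Set.indicator_of_notMem (by simp [A, hx]) _
      · right; exact Set.indicator_of_notMem (by simp [B, hx]) _
    have := hC.of_disjoint hK (hf.indicator (hA χ)) (hg.indicator (hB χ)) hdisj
    refine (le_of_eq ?_).trans (this.trans ?_)
    · congr 2
      ext ⟨s, t⟩
      by_cases hs : s ∈ B χ <;> by_cases ht : t ∈ A χ <;> simp [hh, hs, ht]
    · exact mul_le_mul' (mul_le_mul' le_rfl (eLpNorm_indicator_le f)) (eLpNorm_indicator_le g)
  have hmain : (n : ℂ) * ∫ z in D, h z ∂(ν.prod μ) =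
      4 * ∑ χ : ι → Bool, ∫ z, (B χ ×ˢ A χ).indicator h z ∂(ν.prod μ) := by
    rw [← integral_finsetSum _ fun χ _ => hint' χ, ← integral_indicator hD,
      ← integral_const_mul, ← integral_const_mul]
    exact integral_congr_ae (Eventually.of_forall fun z => (hsum z).symm)
  have hcast : ∀ l : ℕ, ‖(l : ℂ)‖ₑ = l := fun l => by simp [← ofReal_norm]
  have hle : (n : ℝ≥0∞) * ‖∫ z in D, h z ∂(ν.prod μ)‖ₑ ≤
      n * (4 * C * eLpNorm f p μ * eLpNorm g q ν) := by
    have h1 : (n : ℝ≥0∞) * ‖∫ z in D, h z ∂(ν.prod μ)‖ₑ =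
        ‖(n : ℂ) * ∫ z in D, h z ∂(ν.prod μ)‖ₑ := by
      rw [enorm_mul, hcast]
    rw [h1, hmain, enorm_mul]
    have h4 : ‖(4 : ℂ)‖ₑ = 4 := by
      simpa using hcast 4
    rw [h4]
    calc 4 * ‖∑ χ : ι → Bool, ∫ z, (B χ ×ˢ A χ).indicator h z ∂(ν.prod μ)‖ₑ
        ≤ 4 * ∑ χ : ι → Bool, ‖∫ z, (B χ ×ˢ A χ).indicator h z ∂(ν.prod μ)‖ₑ :=
          mul_le_mul' le_rfl (enorm_sum_le _ _)
      _ ≤ 4 * ∑ _χ : ι → Bool, C * eLpNorm f p μ * eLpNorm g q ν :=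
          mul_le_mul' le_rfl (Finset.sum_le_sum fun χ _ => hchi χ)
      _ = n * (4 * C * eLpNorm f p μ * eLpNorm g q ν) := by
          rw [Finset.sum_const, Finset.card_univ, ← hn, nsmul_eq_mul]
          ring
  exact (ENNReal.mul_le_mul_iff_right (by exact_mod_cast hn0) (ENNReal.natCast_ne_top n)).1 hle

/-- For a kernel that is locally square integrable everywhere and for measures without common atoms,
a restricted bound implies a bound for the bilinear form on all test functions. -/
theorem RestrictedlyBounded.enorm_integral_le {N : ℕ} {p q : ℝ≥0∞} {μ ν : Measure (RN N)}
    [IsLocallyFiniteMeasure μ] [IsLocallyFiniteMeasure ν] {K : RN N × RN N → ℂ} {C : ℝ≥0}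
    (hK : LocallyL2On K (ν.prod μ) univ) (hC : RestrictedlyBounded p q μ ν K C)
    (hat : ∀ x : RN N, μ {x} = 0 ∨ ν {x} = 0)
    {f g : RN N → ℂ} (hf : IsTestFun f) (hg : IsTestFun g) :
    ‖∫ z, K z * f z.2 * g z.1 ∂(ν.prod μ)‖ₑ ≤ 4 * C * eLpNorm f p μ * eLpNorm g q ν := by
  have hint : Integrable (fun z => K z * f z.2 * g z.1) (ν.prod μ) :=
    hf.integrable_kernel_mul hg (hK _ (subset_univ _)
      (hg.hasCompactSupport.prod hf.hasCompactSupport))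
  -- Points are encoded injectively and measurably by binary sequences; the first `n` bits define
  -- the `n`-th partition, and distinct points eventually fall into different pieces.
  let b : RN N → ℕ → Bool := MeasurableSpace.mapNatBool (RN N)
  have hb : Measurable b := MeasurableSpace.measurable_mapNatBool _
  have hbi : Function.Injective b := MeasurableSpace.injective_mapNatBool _
  let c : (n : ℕ) → RN N → Fin n → Bool := fun n x i => b x i
  have hc : ∀ n, Measurable (c n) := fun n =>
    measurable_pi_lambda _ fun i => (measurable_pi_apply _).comp hb
  let D : ℕ → Set (RN N × RN N) := fun n => {z | c n z.1 ≠ c n z.2}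
  have hD : ∀ n, MeasurableSet (D n) := fun n =>
    (measurableSet_eq_fun ((hc n).comp measurable_fst) ((hc n).comp measurable_snd)).compl
  have hmono : Monotone D := by
    intro n m hnm z hz hz'
    refine hz (funext fun i => ?_)
    exact congrFun hz' (Fin.castLE hnm i)
  have hU : ⋃ n, D n = {z : RN N × RN N | z.1 = z.2}ᶜ := by
    ext z
    simp only [mem_iUnion, mem_compl_iff, mem_ofPred_eq]
    constructor
    · rintro ⟨n, hn⟩ hz
      exact hn (by rw [hz])
    · intro hz
      by_contra! hcon
      refine hz (hbi (funext fun i => ?_))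
      have h1 : c (i + 1) z.1 = c (i + 1) z.2 := by
        by_contra hne
        exact hcon (i + 1) hne
      exact congrFun h1 (Fin.last i)
  have hlim := tendsto_setIntegral_of_monotone (μ := ν.prod μ) hD hmono hint.integrableOn
  rw [hU, setIntegral_congr_set (t := univ) ?_, setIntegral_univ] at hlim
  · exact le_of_tendsto hlim.enorm
      (Eventually.of_forall fun n => hC.setIntegral_ne_le hK hf hg (hc n))
  · rw [ae_eq_univ, compl_compl]
    exact prod_diagonal_eq_zero hat

/-! ### Duality of `L^p` and `L^q` through test functions -/

/-- This is the extremal function in Hölder's inequality. At `w = 0` the conjugate vanishes, so the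
value given to `0 ^ (r - 2)` is harmless. -/
theorem norm_conj_mul_rpow {r : ℝ} (hr : 1 < r) (w : ℂ) :
    ‖(starRingEnd ℂ) w * ((‖w‖ ^ (r - 2) : ℝ) : ℂ)‖ = ‖w‖ ^ (r - 1) := by
  rw [norm_mul, RCLike.norm_conj, Complex.norm_real, Real.norm_of_nonneg (by positivity)]
  rcases eq_or_ne w 0 with rfl | hw
  · simp [Real.zero_rpow (by linarith : r - 1 ≠ 0)]
  · have : r - 1 = 1 + (r - 2) := by ring
    rw [this, Real.rpow_add (norm_pos_iff.2 hw), Real.rpow_one]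

theorem mul_conj_mul_rpow {r : ℝ} (hr : 1 < r) (w : ℂ) :
    w * ((starRingEnd ℂ) w * ((‖w‖ ^ (r - 2) : ℝ) : ℂ)) = ((‖w‖ ^ r : ℝ) : ℂ) := by
  rcases eq_or_ne w 0 with rfl | hw
  · simp [Real.zero_rpow (by linarith : r ≠ 0)]
  · have : r = 2 + (r - 2) := by ring
    rw [← mul_assoc, Complex.mul_conj, this, Real.rpow_add (norm_pos_iff.2 hw),
      Complex.normSq_eq_norm_sq]
    simp

/-- The `L^p` norm of a function is bounded by its pairings with test functions. -/
theorem eLpNorm_le_of_forall_isTestFun {N : ℕ} {ν : Measure (RN N)} [IsLocallyFiniteMeasure ν]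
    {h : RN N → ℂ} (hm : AEStronglyMeasurable h ν) {p q : ℝ≥0∞} (hp : 1 < p) (hp' : p < ∞)
    (hpq : p⁻¹ + q⁻¹ = 1) {A : ℝ≥0∞}
    (H : ∀ g : RN N → ℂ, IsTestFun g → ‖∫ s, h s * g s ∂ν‖ₑ ≤ A * eLpNorm g q ν) :
    eLpNorm h p ν ≤ A := by
  have hp0 : p ≠ 0 := (zero_lt_one.trans hp).ne'
  have hq0 : q ≠ 0 := by
    rintro rfl
    simp at hpq
  have hq' : q ≠ ∞ := by
    rintro rfl
    simp only [ENNReal.inv_top, add_zero, ENNReal.inv_eq_one] at hpq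
    exact hp.ne' hpq
  set r := p.toReal with hr
  set t := q.toReal with ht
  have hr1 : 1 < r := by
    rw [hr, ← ENNReal.toReal_one]
    exact (ENNReal.toReal_lt_toReal ENNReal.one_ne_top hp'.ne).2 hp
  have ht0 : 0 < t := ENNReal.toReal_pos hq0 hq'
  have hrt : 1 / r + 1 / t = 1 := by
    have := congrArg ENNReal.toReal hpq
    rw [ENNReal.toReal_add (ENNReal.inv_ne_top.2 hp0) (ENNReal.inv_ne_top.2 hq0),
      ENNReal.toReal_inv, ENNReal.toReal_inv, ENNReal.toReal_one] at this
    simpa [one_div] using this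
  have hrt' : (r - 1) * t = r := by
    field_simp at hrt
    linarith
  set h' := hm.mk h with hh'
  have hh'm : Measurable h' := hm.stronglyMeasurable_mk.measurable
  rw [eLpNorm_congr_ae hm.ae_eq_mk, eLpNorm_eq_lintegral_rpow_enorm_toReal hp0 hp'.ne, ← hr]
  -- Truncating both the domain and the values makes the extremal function a test function and `J n`
  -- finite.
  let S : ℕ → Set (RN N) := fun n => Metric.closedBall 0 n ∩ {s | ‖h' s‖ ≤ n}
  have hS : ∀ n, MeasurableSet (S n) := fun n =>
    Metric.isClosed_closedBall.measurableSet.inter (measurableSet_le hh'm.norm measurable_const)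
  have hSfin : ∀ n, ν (S n) < ∞ := fun n =>
    (measure_mono inter_subset_left).trans_lt (isCompact_closedBall (0 : RN N) n).measure_lt_top
  have hSmono : Monotone S := by
    intro a b hab s hs
    have hab' : (a : ℝ) ≤ b := by exact_mod_cast hab
    exact ⟨Metric.closedBall_subset_closedBall hab' hs.1, le_trans hs.2 hab'⟩
  have hSU : ⋃ n, S n = univ := by
    refine eq_univ_of_forall fun s => mem_iUnion.2 ?_
    obtain ⟨n, hn⟩ := exists_nat_ge (max ‖s‖ ‖h' s‖)
    exact ⟨n, by simpa using (le_max_left _ _).trans hn, (le_max_right _ _).trans hn⟩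
  let J : ℕ → ℝ≥0∞ := fun n => ∫⁻ s in S n, ‖h' s‖ₑ ^ r ∂ν
  have hpow : ∀ w : ℂ, ‖w‖ₑ ^ r = ENNReal.ofReal (‖w‖ ^ r) := fun w => by
    rw [← ENNReal.ofReal_rpow_of_nonneg (norm_nonneg _) (by linarith), ofReal_norm]
  have hrpow_le : ∀ n, ∀ s ∈ S n, ∀ a : ℝ, 0 ≤ a → ‖h' s‖ ^ a ≤ (n : ℝ) ^ a := fun n s hs a ha =>
    Real.rpow_le_rpow (norm_nonneg _) hs.2 ha
  have hJfin : ∀ n, J n ≠ ∞ := by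
    intro n
    have h1 : J n ≤ ∫⁻ _ in S n, ENNReal.ofReal ((n : ℝ) ^ r) ∂ν := by
      refine setLIntegral_mono measurable_const fun s hs => ?_
      rw [hpow]
      exact ENNReal.ofReal_le_ofReal (hrpow_le n s hs r (by linarith))
    refine (h1.trans_lt ?_).ne
    rw [setLIntegral_const]
    exact ENNReal.mul_lt_top ENNReal.ofReal_lt_top (hSfin n)
  have hJ : ∀ n, J n ≤ A * J n ^ (1 / t) := by
    intro n
    let g : RN N → ℂ := (S n).indicator fun s =>
      (starRingEnd ℂ) (h' s) * ((‖h' s‖ ^ (r - 2) : ℝ) : ℂ)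
    have hgm : Measurable g := by
      refine Measurable.indicator ?_ (hS n)
      exact (Complex.continuous_conj.measurable.comp hh'm).mul
        (Complex.measurable_ofReal.comp (hh'm.norm.pow_const _))
    have hgt : IsTestFun g := by
      refine ⟨hgm, ⟨(n : ℝ) ^ (r - 1), fun s => ?_⟩, ?_⟩
      · by_cases hs : s ∈ S n
        · simp only [g, Set.indicator_of_mem hs, norm_conj_mul_rpow hr1]
          exact hrpow_le n s hs _ (by linarith)
        · simp only [g, Set.indicator_of_notMem hs, norm_zero]
          positivity
      · refine HasCompactSupport.intro (isCompact_closedBall (0 : RN N) n) fun s hs => ?_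
        exact Set.indicator_of_notMem (fun H => hs H.1) _
    have hgq : eLpNorm g q ν = J n ^ (1 / t) := by
      rw [eLpNorm_indicator_eq_eLpNorm_restrict (hS n),
        eLpNorm_eq_lintegral_rpow_enorm_toReal hq0 hq', ← ht]
      congr 1
      refine lintegral_congr fun s => ?_
      rw [← ofReal_norm, norm_conj_mul_rpow hr1, ENNReal.ofReal_rpow_of_nonneg (by positivity)
        ht0.le, ← Real.rpow_mul (norm_nonneg _), hrt', hpow]
    have hint : ∫ s, h s * g s ∂ν = ((∫ s in S n, ‖h' s‖ ^ r ∂ν : ℝ) : ℂ) := by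
      rw [← integral_complex_ofReal, ← integral_indicator (hS n)]
      refine integral_congr_ae ?_
      filter_upwards [hm.ae_eq_mk] with s hs
      rw [hs]
      by_cases hsn : s ∈ S n
      · simp only [g, Set.indicator_of_mem hsn]
        exact mul_conj_mul_rpow hr1 _
      · simp [g, Set.indicator_of_notMem hsn]
    have hJeq : ‖∫ s, h s * g s ∂ν‖ₑ = J n := by
      have h0 : ∀ s, 0 ≤ ‖h' s‖ ^ r := fun s => by positivity
      rw [hint, ← ofReal_norm, Complex.norm_real,
        Real.norm_of_nonneg (integral_nonneg h0), integral_eq_lintegral_of_nonneg_ae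
          (Eventually.of_forall h0) (hh'm.norm.pow_const _).aestronglyMeasurable]
      simp_rw [← hpow]
      exact ENNReal.ofReal_toReal (hJfin n)
    have := H g hgt
    rwa [hgq, hJeq] at this
  have hJA : ∀ n, J n ^ (1 / r) ≤ A := by
    intro n
    rcases eq_or_ne (J n) 0 with h0 | h0
    · rw [h0, ENNReal.zero_rpow_of_pos (by positivity)]
      exact zero_le
    · have h1 : J n ^ (1 / t) ≠ 0 := by
        simp [ENNReal.rpow_eq_zero_iff, h0, hJfin n]
      have h2 : J n ^ (1 / t) ≠ ∞ := ENNReal.rpow_ne_top_of_nonneg (by positivity) (hJfin n)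
      -- Cancelling `J n ^ (1 / t)`, which is nonzero and finite, turns `J n ≤ A * J n ^ (1 / t)`
      -- into the bound, as `1 / r + 1 / t = 1`.
      refine (ENNReal.mul_le_mul_iff_left h1 h2).1 ?_
      rw [← ENNReal.rpow_add _ _ h0 (hJfin n), hrt, ENNReal.rpow_one]
      exact hJ n
  have hsup : ∫⁻ s, ‖h' s‖ₑ ^ r ∂ν = ⨆ n, J n := by
    rw [← setLIntegral_univ, ← hSU, setLIntegral_iUnion_of_directed _ hSmono.directed_le]
  rw [hsup, one_div, ENNReal.rpow_inv_le_iff (by linarith)]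
  refine iSup_le fun n => ?_
  rw [← ENNReal.rpow_inv_le_iff (by linarith), ← one_div]
  exact hJA n

/-! ### Extension by density -/

/-- The space of test functions. -/
def testFunSubmodule (N : ℕ) : Submodule ℂ (RN N → ℂ) where
  carrier := {f | IsTestFun f}
  zero_mem' := ⟨measurable_const, ⟨0, fun x => by simp⟩, HasCompactSupport.zero⟩
  add_mem' := by
    rintro f g hf hg
    obtain ⟨A, hA⟩ := hf.bounded
    obtain ⟨B, hB⟩ := hg.bounded
    exact ⟨hf.measurable.add hg.measurable,
      ⟨A + B, fun x => (norm_add_le _ _).trans (add_le_add (hA x) (hB x))⟩,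
      hf.hasCompactSupport.add hg.hasCompactSupport⟩
  smul_mem' := by
    rintro c f hf
    obtain ⟨A, hA⟩ := hf.bounded
    refine ⟨hf.measurable.const_smul c, ⟨‖c‖ * A, fun x => ?_⟩, hf.hasCompactSupport.smul_left⟩
    rw [Pi.smul_apply, norm_smul]
    exact mul_le_mul_of_nonneg_left (hA x) (norm_nonneg _)

/-- An integral operator that is bounded on test functions extends to a bounded operator. -/
theorem integralOpBounded_of_eLpNorm_le {N : ℕ} {p : ℝ≥0∞} [Fact (1 ≤ p)] (hp : p ≠ ∞)
    {μ ν : Measure (RN N)} [IsLocallyFiniteMeasure μ] [IsLocallyFiniteMeasure ν]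
    {K : RN N × RN N → ℂ} (hK : IntegralOpWellDefined μ ν K) {C : ℝ≥0}
    (hC : ∀ f : RN N → ℂ, IsTestFun f →
      eLpNorm (integralOp μ K f) p ν ≤ C * eLpNorm f p μ) :
    IntegralOpBounded p μ ν K C := by
  refine ⟨hK, ?_⟩
  have hmem : ∀ f : RN N → ℂ, IsTestFun f → MemLp (integralOp μ K f) p ν := fun f hf =>
    ⟨(hK f hf).2, (hC f hf).trans_lt
      (ENNReal.mul_lt_top ENNReal.coe_lt_top (hf.memLp p μ).2)⟩
  have hadd : ∀ f g : RN N → ℂ, IsTestFun f → IsTestFun g →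
      integralOp μ K (f + g) =ᵐ[ν] integralOp μ K f + integralOp μ K g := by
    intro f g hf hg
    filter_upwards [(hK f hf).1, (hK g hg).1] with s hs hs'
    simp only [integralOp, Pi.add_apply, mul_add]
    exact integral_add hs hs'
  have hsmul : ∀ (c : ℂ) (f : RN N → ℂ), integralOp μ K (c • f) = c • integralOp μ K f := by
    intro c f
    ext s
    simp only [integralOp, Pi.smul_apply, smul_eq_mul]
    rw [← integral_const_mul]
    congr 1
    ext t
    ring
  let e : testFunSubmodule N →ₗ[ℂ] Lp ℂ p μ :=
    { toFun := fun f => (IsTestFun.memLp f.2 p μ).toLp f.1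
      map_add' := fun f g => MemLp.toLp_add _ _
      map_smul' := fun c f => MemLp.toLp_const_smul c _ }
  let T : testFunSubmodule N →ₗ[ℂ] Lp ℂ p ν :=
    { toFun := fun f => (hmem f.1 f.2).toLp _
      map_add' := fun f g => by
        rw [← MemLp.toLp_add]
        exact MemLp.toLp_congr _ _ (hadd f.1 g.1 f.2 g.2)
      map_smul' := fun c f => by
        rw [RingHom.id_apply, ← MemLp.toLp_const_smul]
        exact MemLp.toLp_congr _ _ (Eventually.of_forall fun s =>
          congrFun (hsmul c f.1) s) }
  have hdense : DenseRange e := by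
    intro F
    rw [EMetric.mem_closure_iff]
    intro η hη
    obtain ⟨g, hgs, hg, hgc, -⟩ := (Lp.memLp F).exists_hasCompactSupport_eLpNorm_sub_le hp
      (ENNReal.half_pos hη.ne').ne'
    -- The value `∞` is treated apart because `η / 2 < η` fails there.
    rcases eq_or_ne η ∞ with rfl | hη'
    · refine ⟨e 0, mem_range_self _, ?_⟩
      exact edist_lt_top _ _
    have hgt : IsTestFun g :=
      ⟨hgc.measurable, hgs.exists_bound_of_continuous hgc, hgs⟩
    refine ⟨e ⟨g, hgt⟩, mem_range_self _, ?_⟩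
    rw [Lp.edist_def]
    refine lt_of_le_of_lt ?_ (ENNReal.half_lt_self hη.ne' hη')
    refine (eLpNorm_congr_ae ?_).trans_le hg
    exact (EventuallyEq.refl _ _).sub (hgt.memLp p μ).coeFn_toLp
  have hle : ∀ f, ‖T f‖ ≤ (C : ℝ) * ‖e f‖ := by
    intro f
    have h1 := ENNReal.toReal_mono (ENNReal.mul_ne_top ENNReal.coe_ne_top
      (IsTestFun.memLp f.2 p μ).2.ne) (hC f.1 f.2)
    rw [ENNReal.toReal_mul, ENNReal.coe_toReal] at h1
    change ‖(hmem f.1 f.2).toLp _‖ ≤ (C : ℝ) * ‖(IsTestFun.memLp f.2 p μ).toLp f.1‖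
    rwa [Lp.norm_toLp, Lp.norm_toLp]
  refine ⟨T.extendOfNorm e, LinearMap.opNorm_extendOfNorm_le hdense C.2 hle, fun f hf => ?_⟩
  have h1 := LinearMap.extendOfNorm_eq (f := T) hdense ⟨C, hle⟩ ⟨f, hf⟩
  have h2 : e ⟨f, hf⟩ = (hf.memLp p μ).toLp f := rfl
  rw [← h2, h1]
  exact (hmem f hf).coeFn_toLp

/-- If the kernel is locally square integrable everywhere and the measures have no common atoms,
restricted boundedness implies boundedness. -/
theorem RestrictedlyBounded.integralOpBounded {N : ℕ} {p q : ℝ≥0∞} [Fact (1 ≤ p)] (hp : 1 < p)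
    (hp' : p < ∞) (hpq : p⁻¹ + q⁻¹ = 1) {μ ν : Measure (RN N)}
    [IsLocallyFiniteMeasure μ] [IsLocallyFiniteMeasure ν] {K : RN N × RN N → ℂ} {C : ℝ≥0}
    (hm : AEStronglyMeasurable K (ν.prod μ)) (hK : LocallyL2On K (ν.prod μ) univ)
    (hC : RestrictedlyBounded p q μ ν K C) (hat : ∀ x : RN N, μ {x} = 0 ∨ ν {x} = 0) :
    IntegralOpBounded p μ ν K (4 * C : ℝ≥0) := by
  have hwd := integralOpWellDefined_of_locallyL2On hm hK
  refine integralOpBounded_of_eLpNorm_le hp'.ne hwd fun f hf => ?_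
  refine eLpNorm_le_of_forall_isTestFun (hwd f hf).2 hp hp' hpq fun g hg => ?_
  have hint : Integrable (fun z => K z * f z.2 * g z.1) (ν.prod μ) :=
    hf.integrable_kernel_mul hg (hK _ (subset_univ _)
      (hg.hasCompactSupport.prod hf.hasCompactSupport))
  have h1 : ∫ s, integralOp μ K f s * g s ∂ν = ∫ z, K z * f z.2 * g z.1 ∂(ν.prod μ) := by
    rw [integral_prod _ hint]
    simp only [integralOp, integral_mul_const]
  rw [h1]
  simpa using hC.enorm_integral_le hK hat hf hg

/-! ### The main result -/

open FourierTransform in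
theorem proposition2p7 (N k : ℕ) (hk : (N : ℝ) / 2 < k) (m : RN N → ℂ)
    (hm0 : ∀ᶠ x in 𝓝 (0 : RN N), m x = 0)
    (hm1 : MemHk k (fun x => 1 - m x)) :
    -- elements of `H^k`, `k > N / 2`, are read through their (unique) continuous representative
    ∃ m' : RN N → ℂ, Continuous m' ∧ m' =ᵐ[volume] m ∧
      -- (1)
      (∀ a : ℝ, 0 < a →
        TendstoUniformlyOn (mollifier m') (fun _ => (1 : ℂ)) (𝓝[>] (0 : ℝ))
          {z | a < dist z.1 z.2}) ∧
      -- (2)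
      (∀ (μ ν : Measure (RN N)) [IsLocallyFiniteMeasure μ] [IsLocallyFiniteMeasure ν]
        (K : RN N × RN N → ℂ), IsSingularKernel μ ν K → ∀ ε : ℝ, 0 < ε →
          LocallyL2On (fun z => K z * mollifier m' ε z) (ν.prod μ) univ ∧
          IntegralOpWellDefined μ ν (fun z => K z * mollifier m' ε z)) ∧
      -- (3)
      (∀ (p q : ℝ≥0∞) [Fact (1 ≤ p)], 1 < p → p < ∞ → p⁻¹ + q⁻¹ = 1 →
        ∀ (μ ν : Measure (RN N)) [IsLocallyFiniteMeasure μ] [IsLocallyFiniteMeasure ν]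
          (K : RN N × RN N → ℂ), IsSingularKernel μ ν K →
          (∀ x : RN N, μ {x} = 0 ∨ ν {x} = 0) →
          (∃ C : ℝ≥0, RestrictedlyBounded p q μ ν K C) →
          ∃ C' : ℝ, ∀ ε : ℝ, 0 < ε →
            IntegralOpBounded p μ ν (fun z => K z * mollifier m' ε z) C') := by
  obtain ⟨v, hv, huv⟩ := hm1.exists_ae_eq_fourier hk
  have hcont : Continuous (𝓕 v) := continuous_fourier_of_integrable hv
  have hm'c : Continuous fun x => 1 - 𝓕 v x := continuous_const.sub hcont
  have hae : (fun x => 1 - 𝓕 v x) =ᵐ[volume] m := by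
    filter_upwards [huv] with x hx
    rw [← hx]
    ring
  obtain ⟨δ, hδ, hδm⟩ := Metric.eventually_nhds_iff_ball.1 hm0
  -- The continuous representative is a priori zero only almost everywhere on the ball; continuity
  -- makes it zero at every point.
  have hzero : ∀ x ∈ Metric.ball (0 : RN N) δ, 1 - 𝓕 v x = 0 := by
    have h1 : (fun x => 1 - 𝓕 v x) =ᵐ[volume.restrict (Metric.ball (0 : RN N) δ)]
        fun _ => (0 : ℂ) := by
      filter_upwards [ae_restrict_of_ae hae, ae_restrict_mem Metric.isOpen_ball.measurableSet]
        with x hx hx'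
      rw [hx, hδm x hx']
    exact fun x hx => Measure.eqOn_open_of_ae_eq h1 Metric.isOpen_ball hm'c.continuousOn
      continuousOn_const hx
  have hmoll : ∀ ε : ℝ, Continuous (mollifier (fun x => 1 - 𝓕 v x) ε) := fun ε =>
    hm'c.comp (by fun_prop)
  have hloc : ∀ (μ ν : Measure (RN N)) (K : RN N × RN N → ℂ), IsSingularKernel μ ν K →
      ∀ ε : ℝ, 0 < ε →
      LocallyL2On (fun z => K z * mollifier (fun x => 1 - 𝓕 v x) ε z) (ν.prod μ) univ := by
    intro μ ν K hK ε hε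
    -- Rescaling by `ε` turns the radius `δ` into the width `ε * δ` around the diagonal.
    refine hK.locallyL2On_mul (hmoll ε) (mul_pos hε hδ) fun z hz => hzero _ ?_
    rw [mem_ball_zero_iff, norm_smul, norm_inv, Real.norm_of_nonneg hε.le, ← dist_eq_norm,
      dist_comm, inv_mul_lt_iff₀ hε]
    exact hz
  refine ⟨fun x => 1 - 𝓕 v x, hm'c, hae, ?_, ?_, ?_⟩
  · intro a ha
    refine tendstoUniformlyOn_mollifier ?_ ha
    have h1 : Tendsto (𝓕 v) (cocompact (RN N)) (𝓝 0) := by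
      simpa only [← Real.fourier_eq] using tendsto_integral_exp_inner_smul_cocompact v
    simpa using h1.const_sub 1
  · intro μ ν _ _ K hK ε hε
    exact ⟨hloc μ ν K hK ε hε, integralOpWellDefined_of_locallyL2On
      (hK.1.mul (hmoll ε).aestronglyMeasurable) (hloc μ ν K hK ε hε)⟩
  · intro p q _ hp hp' hpq μ ν _ _ K hK hat ⟨C, hC⟩
    -- The constant is `4 * (C * (1 + ‖v‖₁))`, which does not involve `ε`.
    exact ⟨_, fun ε hε => (hC.mul_mollifier hK hv ε).integralOpBounded hp hp' hpq
      (hK.1.mul (hmoll ε).aestronglyMeasurable) (hloc μ ν K hK ε hε) hat⟩
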